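/- There is an absolute constant $C>0$ such that the following holds. Let $l\ge 1$ and $d_0,\dots,d_l\ge 1$ be integers, let $\epsilon>0$ and $\delta\in(0,1)$, and, in the degenerate case $l=d_0=d_1=1$, assume in addition that $\min\{\epsilon,\delta\}\le \tfrac12$. Let $\sigma(t)=\max\{t,0\}$ act coordinatewise and let $$\mathcal F=\{\,f:\mathbb R^{d_0}\to\mathbb R^{d_l},\ f(\mathbf x)=\mathbf W_l\,\sigma(\mathbf W_{l-1}\cdots\sigma(\mathbf W_1\mathbf x))\ :\ \mathbf W_i\in\mathbb R^{d_i\times d_{i-1}},\ \|\mathbf W_i\|\le 1 \text{ for } 1\le i\le l\,\},$$ where $\|\mathbf W_i\|$ is the spectral norm. For $1\le i\le l$ let $n_i$ be any integer with $$n_i\ \ge\ C\,d_{i-1}\log\frac{d_{i-1}d_i\,l}{\min\{\epsilon,\delta\}}$$ (for instance the smallest one), and let $\mathbf M_{2i-1}\in\mathbb R^{n_i\times d_{i-1}}$ and $\mathbf M_{2i}\in\mathbb R^{d_i\times n_i}$ be random matrices such that all entries of $\mathbf M_1,\dots,\mathbf M_{2l}$ are independent and uniformly distributed on $[-1,1]$.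 Then, with probability at least $1-\delta$, the following holds simultaneously for every $f\in\mathcal F$: there are binary ($0/1$-valued) matrices $\mathbf S_1,\dots,\mathbf S_{2l}$, with $\mathbf S_k$ of the same dimension as $\mathbf M_k$, such that $$\sup_{\|\mathbf x\|\le 1}\bigl\|f(\mathbf x)-(\mathbf S_{2l}\odot\mathbf M_{2l})\,\sigma((\mathbf S_{2l-1}\odot\mathbf M_{2l-1})\cdots\sigma((\mathbf S_1\odot\mathbf M_1)\mathbf x))\bigr\|<\epsilon ,$$ where $\odot$ is the entrywise product and $\|\cdot\|$ on vectors is the Euclidean norm. -/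

import Mathlib

open MeasureTheory ProbabilityTheory
open scoped Matrix Matrix.Norms.L2Operator

noncomputable section

/-- Coordinatewise ReLU activation `σ(t) = max t 0`. -/
def relu {m : ℕ} (v : EuclideanSpace ℝ (Fin m)) : EuclideanSpace ℝ (Fin m) :=
  WithLp.toLp 2 (fun i => max (v i) 0)

/-- The linear map `x ↦ A x` between Euclidean spaces. -/
def applyMat {m n : ℕ} (A : Matrix (Fin m) (Fin n) ℝ) (x : EuclideanSpace ℝ (Fin n)) :
    EuclideanSpace ℝ (Fin m) :=
  WithLp.toLp 2 (A *ᵥ x.ofLp)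

/-- `hiddenLayer w A x k = σ(A_{k-1} σ(A_{k-2} ⋯ σ(A_0 x)))`, the output of the first `k` layers,
each followed by the activation. -/
def hiddenLayer (w : ℕ → ℕ) (A : ∀ k : ℕ, Matrix (Fin (w (k + 1))) (Fin (w k)) ℝ)
    (x : EuclideanSpace ℝ (Fin (w 0))) : ∀ k : ℕ, EuclideanSpace ℝ (Fin (w k))
  | 0 => x
  | k + 1 => relu (applyMat (A k) (hiddenLayer w A x k))

/-- The ReLU network with `L` layers `x ↦ A_{L-1} σ(A_{L-2} ⋯ σ(A_0 x))`: layer widths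
`w 0, …, w L`, no activation after the last layer. Only `A_0, …, A_{L-1}` are used. -/
def reluNetwork (w : ℕ → ℕ) (A : ∀ k : ℕ, Matrix (Fin (w (k + 1))) (Fin (w k)) ℝ) :
    ∀ L : ℕ, EuclideanSpace ℝ (Fin (w 0)) → EuclideanSpace ℝ (Fin (w L))
  | 0, x => x
  | L + 1, x => applyMat (A L) (hiddenLayer w A x L)

/-- The target class: ReLU networks with `l` layers and layer widths `d 0, …, d l`, all of whose
weight matrices have spectral norm (`ℓ²` operator norm) at most `1`. -/
def targetClass (d : ℕ → ℕ) (l : ℕ) :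
    Set (EuclideanSpace ℝ (Fin (d 0)) → EuclideanSpace ℝ (Fin (d l))) :=
  {f | ∃ W : ∀ i : ℕ, Matrix (Fin (d (i + 1))) (Fin (d i)) ℝ,
    (∀ i < l, ‖W i‖ ≤ 1) ∧ f = reluNetwork d W l}

/-- A binary (pruning) matrix. -/
def IsMask {m n : ℕ} (S : Matrix (Fin m) (Fin n) ℝ) : Prop :=
  ∀ i j, S i j = 0 ∨ S i j = 1

/-- The random matrices `M_0, …, M_{L-1}`, with `M_k` of dimension `w (k+1) × w k`, have entries
that are all jointly independent and uniformly distributed on `[-1, 1]`. -/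
def IsUniformInit {Ω : Type*} [MeasurableSpace Ω] (P : Measure Ω) (w : ℕ → ℕ) (L : ℕ)
    (M : ∀ k : ℕ, Ω → Matrix (Fin (w (k + 1))) (Fin (w k)) ℝ) : Prop :=
  iIndepFun (fun (e : Σ k : Fin L, Fin (w (k + 1)) × Fin (w k)) (ω : Ω) =>
    M e.1 ω e.2.1 e.2.2) P ∧
  ∀ k < L, ∀ i j, pdf.IsUniform (fun ω => M k ω i j) (Set.Icc (-1 : ℝ) 1) P volume

end

/-! Each target layer `W` is imitated by one pruned block of two random layers. The first mask ties
every used hidden neuron to a single input coordinate `j`, so that it computes `σ(u x_j)`. Neurons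
with `u > 0` see only the positive part of `x_j`, the others only its negative part. The second mask
then has to select products `v * max (±u) 0` whose sums approximate `± W i j`. The first mask does
not depend on `i`, so all outputs share the same hidden neurons and width of order `a log` suffices,
rather than `a b log`.

The selection is a random subset sum problem, and logarithmically many terms suffice
(`pi_not_subset_sum_approx_le`). Let `a` be the length of the part of an interval of length `L`
reachable by the terms used so far. A new term translates this part and on average covers a fixed
proportion of what was missing, so the ratio `L / a - 1` of uncovered to covered length contracts
geometrically in expectation (`lintegral_uncovered_ratio_le`). Markov's inequality then leaves a gap
too short to contain an interval of length `ε`. All targets are reached on the same event, which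
gives the uniformity over the whole class.

A union bound over entries, groups and signs handles one block
(`measure_not_approximatesLayers_le`), and another one handles the layers. Layers of norm at most
`1` and the 1-Lipschitz ReLU let relative errors `e` compound only to `(1 + e) ^ l - 1`
(`norm_reluNetwork_sub_le`). -/

/-! ### Random subset sums -/

/-- Pairs `(x, z)` such that `z` is reached from a point of `A` by adding some of the terms of `x`
one after the other, without leaving `I`. -/
def reachable (I A : Set ℝ) : ∀ n : ℕ, Set ((Fin n → ℝ) × ℝ)
  | 0 => {p | p.2 ∈ A}
  | n + 1 => {p | p.2 ∈ I ∧ ((Fin.tail p.1, p.2) ∈ reachable I A n ∨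
      (Fin.tail p.1, p.2 - p.1 0) ∈ reachable I A n)}

lemma measurableSet_reachable {I A : Set ℝ} (hI : MeasurableSet I) (hA : MeasurableSet A) (n : ℕ) :
    MeasurableSet (reachable I A n) := by
  induction n with
  | zero => exact measurable_snd hA
  | succ n ih =>
    have htail : Measurable (fun p : (Fin (n + 1) → ℝ) × ℝ => Fin.tail p.1) := by
      refine measurable_pi_lambda _ fun i => ?_
      exact (measurable_pi_apply i.succ).comp measurable_fst
    have h0 : Measurable (fun p : (Fin (n + 1) → ℝ) × ℝ => p.1 0) :=
      (measurable_pi_apply 0).comp measurable_fst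
    exact (measurable_snd hI).inter (((htail.prodMk measurable_snd) ih).union
      ((htail.prodMk (measurable_snd.sub h0)) ih))

lemma reachable_subset {I A : Set ℝ} (hAI : A ⊆ I) {n : ℕ} {x : Fin n → ℝ} {z : ℝ}
    (h : (x, z) ∈ reachable I A n) : z ∈ I := by
  cases n with
  | zero => exact hAI h
  | succ n => exact h.1

lemma subset_reachable {I A : Set ℝ} (hAI : A ⊆ I) {n : ℕ} (x : Fin n → ℝ) {z : ℝ}
    (h : z ∈ A) : (x, z) ∈ reachable I A n := by
  induction n with
  | zero => exact h
  | succ n ih => exact ⟨hAI h, Or.inl (ih _)⟩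

lemma exists_subset_sum_of_reachable {I A : Set ℝ} {n : ℕ} {x : Fin n → ℝ} {z : ℝ}
    (h : (x, z) ∈ reachable I A n) : ∃ T : Finset (Fin n), z - ∑ i ∈ T, x i ∈ A := by
  induction n generalizing z with
  | zero =>
    have h' : z ∈ A := h
    exact ⟨∅, by simpa using h'⟩
  | succ n ih =>
    rcases h.2 with h | h
    · obtain ⟨T, hT⟩ := ih h
      exact ⟨T.map (Fin.succEmb n), by simpa [Fin.tail] using hT⟩
    · obtain ⟨T, hT⟩ := ih h
      refine ⟨insert 0 (T.map (Fin.succEmb n)), ?_⟩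
      rw [Finset.sum_insert (by simp)]
      simpa [Fin.tail, sub_sub] using hT

lemma measurable_volume_shift_diff {I A : Set ℝ} (hI : MeasurableSet I) (hA : MeasurableSet A) :
    Measurable (fun x : ℝ => volume {z | z ∈ I \ A ∧ z - x ∈ A}) := by
  have hE : MeasurableSet {p : ℝ × ℝ | p.2 ∈ I \ A ∧ p.2 - p.1 ∈ A} :=
    (measurable_snd (hI.diff hA)).inter ((measurable_snd.sub measurable_fst) hA)
  exact measurable_measure_prodMk_left hE

/-- Tonelli: the mean newly covered length is the integral over uncovered `z` of the probability
that the shift covers `z`. -/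
lemma le_lintegral_volume_shift_diff {μ : Measure ℝ} [IsProbabilityMeasure μ] {I A : Set ℝ}
    {c : ENNReal} (hI : MeasurableSet I) (hA : MeasurableSet A)
    (hμ : ∀ z ∈ I, c ≤ μ {x | z - x ∈ A}) :
    c * volume (I \ A) ≤ ∫⁻ x, volume {z | z ∈ I \ A ∧ z - x ∈ A} ∂μ := by
  have hE : MeasurableSet {p : ℝ × ℝ | p.2 ∈ I \ A ∧ p.2 - p.1 ∈ A} :=
    (measurable_snd (hI.diff hA)).inter ((measurable_snd.sub measurable_fst) hA)
  have h1 := Measure.prod_apply (μ := μ) (ν := volume) hE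
  have h2 := Measure.prod_apply_symm (μ := μ) (ν := volume) hE
  calc c * volume (I \ A) = ∫⁻ z in I \ A, c := by simp
    _ ≤ ∫⁻ z in I \ A, μ ((fun x => (x, z)) ⁻¹' {p : ℝ × ℝ | p.2 ∈ I \ A ∧ p.2 - p.1 ∈ A}) := by
        refine setLIntegral_mono' (hI.diff hA) fun z hz => ?_
        refine (hμ z hz.1).trans (measure_mono fun x hx => ⟨hz, hx⟩)
    _ ≤ ∫⁻ z, μ ((fun x => (x, z)) ⁻¹' {p : ℝ × ℝ | p.2 ∈ I \ A ∧ p.2 - p.1 ∈ A}) :=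
        setLIntegral_le_lintegral _ _
    _ = _ := by rw [← h2, h1]; rfl

/-- By convexity in `b`, the function lies below its chord on `[0, a]`. The bound is affine in `b`,
so only the mean of the gain `b` is needed afterwards. -/
lemma inv_add_le_chord {L a b : ℝ} (hL : 0 ≤ L) (ha : 0 < a) (hb : 0 ≤ b) (hba : b ≤ a) :
    L / (a + b) - 1 ≤ L / a - 1 - L / (2 * a ^ 2) * b := by
  have : L / a - 1 - L / (2 * a ^ 2) * b - (L / (a + b) - 1)
      = L * b * (a - b) / (2 * a ^ 2 * (a + b)) := by
    have : a + b ≠ 0 := by positivity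
    field_simp
    ring
  have h2 : 0 ≤ L * b * (a - b) / (2 * a ^ 2 * (a + b)) := by
    have := sub_nonneg.2 hba
    positivity
  linarith

/-- One random shift multiplies the ratio of uncovered to covered length by at most
`1 - κ L / 2` on average. -/
lemma lintegral_uncovered_ratio_le {μ : Measure ℝ} [IsProbabilityMeasure μ] {I A : Set ℝ}
    {L κ : ℝ} (hL : 0 < L) (hκ : 0 ≤ κ) (hI : MeasurableSet I) (hA : MeasurableSet A)
    (hAI : A ⊆ I) (hIL : volume I = ENNReal.ofReal L) (hA0 : volume A ≠ 0)
    (hμ : ∀ z ∈ I, ENNReal.ofReal κ * volume A ≤ μ {x | z - x ∈ A}) :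
    ∫⁻ x, ENNReal.ofReal (L / volume.real (A ∪ {z | z ∈ I ∧ z - x ∈ A}) - 1) ∂μ
      ≤ ENNReal.ofReal (1 - κ * L / 2) * ENNReal.ofReal (L / volume.real A - 1) := by
  have hIfin : volume I ≠ ⊤ := by simp [hIL]
  have hAfin : volume A ≠ ⊤ := measure_ne_top_of_subset hAI hIfin
  set a := volume.real A with ha
  have hapos : 0 < a := ENNReal.toReal_pos hA0 hAfin
  have hIreal : volume.real I = L := by simp [measureReal_def, hIL, hL.le]
  have haL : a ≤ L := hIreal ▸ measureReal_mono hAI hIfin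
  set b : ℝ → ℝ := fun x => volume.real {z | z ∈ I \ A ∧ z - x ∈ A} with hb
  have hbm (x : ℝ) : MeasurableSet {z | z ∈ I \ A ∧ z - x ∈ A} :=
    (hI.diff hA).inter ((measurable_id.sub_const x) hA)
  have hbsub (x : ℝ) : {z | z ∈ I \ A ∧ z - x ∈ A} ⊆ I := fun z hz => hz.1.1
  have hbfin (x : ℝ) : volume {z | z ∈ I \ A ∧ z - x ∈ A} ≠ ⊤ :=
    measure_ne_top_of_subset (hbsub x) hIfin
  have hb0 (x : ℝ) : 0 ≤ b x := measureReal_nonneg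
  have hshift (x : ℝ) : volume {z | z - x ∈ A} = volume A := by
    simp_rw [sub_eq_add_neg]
    exact measure_preimage_add_right volume (-x) A
  -- The gain lies in a translate of `A`; this keeps `b x` in the range where the chord bound is
  -- valid.
  have hba (x : ℝ) : b x ≤ a := by
    refine ENNReal.toReal_mono hAfin ?_
    rw [← hshift x]
    exact measure_mono fun z hz => hz.2
  have hunion (x : ℝ) : volume.real (A ∪ {z | z ∈ I ∧ z - x ∈ A}) = a + b x := by
    have : A ∪ {z | z ∈ I ∧ z - x ∈ A} = A ∪ {z | z ∈ I \ A ∧ z - x ∈ A} := by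
      ext z
      simp only [Set.mem_union, Set.mem_ofPred_eq, Set.mem_sdiff]
      tauto
    rw [this, measureReal_union _ (hbm x) hAfin (hbfin x)]
    exact Set.disjoint_left.2 fun z hz hz' => hz'.1.2 hz
  have habL (x : ℝ) : a + b x ≤ L := by
    rw [← hunion x, ← hIreal]
    exact measureReal_mono (Set.union_subset hAI fun z hz => hz.1) hIfin
  have hbmeas : Measurable b := (measurable_volume_shift_diff hI hA).ennreal_toReal
  have hbint : Integrable b μ :=
    Integrable.of_bound hbmeas.aestronglyMeasurable a
      (Filter.Eventually.of_forall fun x => by simpa [abs_of_nonneg (hb0 x)] using hba x)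
  have hbge : κ * a * (L - a) ≤ ∫ x, b x ∂μ := by
    have h1 := le_lintegral_volume_shift_diff (μ := μ) hI hA hμ
    have h2 : ∫ x, b x ∂μ = (∫⁻ x, volume {z | z ∈ I \ A ∧ z - x ∈ A} ∂μ).toReal :=
      integral_toReal (measurable_volume_shift_diff hI hA).aemeasurable
        (Filter.Eventually.of_forall fun x => (hbfin x).lt_top)
    have h3 : ∫⁻ x, volume {z | z ∈ I \ A ∧ z - x ∈ A} ∂μ ≠ ⊤ := by
      refine ((lintegral_mono fun x => measure_mono (hbsub x)).trans_lt ?_).ne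
      simp [hIL]
    have h4 := ENNReal.toReal_mono h3 h1
    rw [← h2, measure_sdiff hAI hA.nullMeasurableSet hAfin, ENNReal.toReal_mul, ENNReal.toReal_mul,
      ENNReal.toReal_ofReal hκ, ENNReal.toReal_sub_of_le (measure_mono hAI) hIfin, hIL,
      ENNReal.toReal_ofReal hL.le] at h4
    exact h4
  set h : ℝ → ℝ := fun x => L / a - 1 - L / (2 * a ^ 2) * b x with hh
  have hfh (x : ℝ) : L / (a + b x) - 1 ≤ h x := inv_add_le_chord hL.le hapos (hb0 x) (hba x)
  have hf0 (x : ℝ) : 0 ≤ L / (a + b x) - 1 := by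
    have := hb0 x
    rw [sub_nonneg, le_div_iff₀ (by positivity), one_mul]
    exact habL x
  have hhint : Integrable h μ := (integrable_const _).sub (hbint.const_mul _)
  calc ∫⁻ x, ENNReal.ofReal (L / volume.real (A ∪ {z | z ∈ I ∧ z - x ∈ A}) - 1) ∂μ
      ≤ ∫⁻ x, ENNReal.ofReal (h x) ∂μ := by
        refine lintegral_mono fun x => ENNReal.ofReal_le_ofReal ?_
        rw [hunion x]
        exact hfh x
    _ = ENNReal.ofReal (∫ x, h x ∂μ) :=
        (ofReal_integral_eq_lintegral_ofReal hhint
          (Filter.Eventually.of_forall fun x => (hf0 x).trans (hfh x))).symm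
    _ ≤ ENNReal.ofReal ((1 - κ * L / 2) * (L / a - 1)) := by
        refine ENNReal.ofReal_le_ofReal ?_
        rw [hh, integral_sub (integrable_const _) (hbint.const_mul _), integral_const_mul]
        simp only [integral_const, probReal_univ, one_smul]
        have : L / (2 * a ^ 2) * (κ * a * (L - a)) ≤ L / (2 * a ^ 2) * ∫ x, b x ∂μ :=
          mul_le_mul_of_nonneg_left hbge (by positivity)
        have h5 : L / (2 * a ^ 2) * (κ * a * (L - a)) = κ * L / 2 * (L / a - 1) := by
          field_simp
        linarith
    _ = _ := by
        rw [ENNReal.ofReal_mul']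
        rw [sub_nonneg, le_div_iff₀ hapos, one_mul]
        exact haL

lemma lintegral_uncovered_ratio_pi_le {μ : Measure ℝ} [IsProbabilityMeasure μ] {I A : Set ℝ}
    {L κ : ℝ} (hL : 0 < L) (hκ : 0 ≤ κ) (hI : MeasurableSet I) (hA : MeasurableSet A)
    (hAI : A ⊆ I) (hIL : volume I = ENNReal.ofReal L) (hA0 : volume A ≠ 0)
    (hμ : ∀ z ∈ I, ∀ B ⊆ I, MeasurableSet B →
      ENNReal.ofReal κ * volume B ≤ μ {x | z - x ∈ B}) (n : ℕ) :
    ∫⁻ x, ENNReal.ofReal (L / volume.real {z | (x, z) ∈ reachable I A n} - 1)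
        ∂(Measure.pi fun _ : Fin n => μ)
      ≤ ENNReal.ofReal (1 - κ * L / 2) ^ n * ENNReal.ofReal (L / volume.real A - 1) := by
  have hmeas (n : ℕ) : Measurable fun x : Fin n → ℝ =>
      ENNReal.ofReal (L / volume.real {z | (x, z) ∈ reachable I A n} - 1) :=
    (((measurable_measure_prodMk_left
      (measurableSet_reachable hI hA n)).ennreal_toReal.const_div L).sub_const 1).ennreal_ofReal
  induction n with
  | zero =>
    simp [reachable]
  | succ n ih =>
    -- Coordinate `0` is the last term to be added, so for fixed other coordinates it acts as one
    -- random shift of the set already reached.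
    have hmp := measurePreserving_piFinSuccAbove (fun _ : Fin (n + 1) => μ) 0
    have hcomp : ∀ x : Fin (n + 1) → ℝ,
        ENNReal.ofReal (L / volume.real {z | (x, z) ∈ reachable I A (n + 1)} - 1)
          = (fun p : ℝ × (Fin n → ℝ) => ENNReal.ofReal
            (L / volume.real {z | (Fin.cons p.1 p.2, z) ∈ reachable I A (n + 1)} - 1))
            (MeasurableEquiv.piFinSuccAbove (fun _ => ℝ) 0 x) := by
      intro x
      have : (Fin.cons (MeasurableEquiv.piFinSuccAbove (fun _ => ℝ) 0 x).1
          (MeasurableEquiv.piFinSuccAbove (fun _ => ℝ) 0 x).2 : Fin (n + 1) → ℝ) = x :=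
        Fin.cons_self_tail x
      simp only [this]
    have hcons : Measurable fun p : ℝ × (Fin n → ℝ) => (Fin.cons p.1 p.2 : Fin (n + 1) → ℝ) := by
      refine measurable_pi_lambda _ fun i => ?_
      refine Fin.cases ?_ (fun j => ?_) i
      · simpa using measurable_fst
      · simpa [Function.comp_def] using (measurable_pi_apply (X := fun _ : Fin n => ℝ) j).comp
          (measurable_snd (α := ℝ))
    have hg : Measurable fun p : ℝ × (Fin n → ℝ) => ENNReal.ofReal
        (L / volume.real {z | (Fin.cons p.1 p.2, z) ∈ reachable I A (n + 1)} - 1) :=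
      (hmeas (n + 1)).comp hcons
    rw [lintegral_congr hcomp, hmp.lintegral_comp hg, lintegral_prod_symm' _ hg]
    calc _ ≤ ∫⁻ y, ENNReal.ofReal (1 - κ * L / 2) *
            ENNReal.ofReal (L / volume.real {z | (y, z) ∈ reachable I A n} - 1)
            ∂(Measure.pi fun _ : Fin n => μ) := by
          refine lintegral_mono fun y => ?_
          set B := {z | (y, z) ∈ reachable I A n} with hB
          have hBI : B ⊆ I := fun z hz => reachable_subset hAI hz
          have hAB : A ⊆ B := fun z hz => subset_reachable hAI y hz
          have hBm : MeasurableSet B := measurable_prodMk_left (measurableSet_reachable hI hA n)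
          have hstep := lintegral_uncovered_ratio_le (μ := μ) hL hκ hI hBm hBI hIL
            (fun h => hA0 (measure_mono_null hAB h)) (fun z hz => hμ z hz B hBI hBm)
          have hset (x : ℝ) : {z | ((Fin.cons x y : Fin (n + 1) → ℝ), z) ∈ reachable I A (n + 1)}
              = B ∪ {z | z ∈ I ∧ z - x ∈ B} := by
            ext z
            simp only [reachable, Set.mem_ofPred_eq, Fin.tail_cons, Fin.cons_zero, Set.mem_union, hB]
            constructor
            · rintro ⟨h1, h2 | h2⟩
              · exact Or.inl h2
              · exact Or.inr ⟨h1, h2⟩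
            · rintro (h | h)
              · exact ⟨hBI h, Or.inl h⟩
              · exact ⟨h.1, Or.inr h.2⟩
          simp only [hset]
          exact hstep
      _ = ENNReal.ofReal (1 - κ * L / 2) * ∫⁻ y,
            ENNReal.ofReal (L / volume.real {z | (y, z) ∈ reachable I A n} - 1)
            ∂(Measure.pi fun _ : Fin n => μ) := lintegral_const_mul _ (hmeas n)
      _ ≤ _ := by
          rw [pow_succ', mul_assoc]
          gcongr

/-- A random subset sum bound: if the law `μ` of the terms dominates `κ` times Lebesgue measure
near `0`, then with high probability all points of an interval of length `L` are approximated by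
subset sums of `n` independent terms. -/
theorem pi_not_subset_sum_approx_le {μ : Measure ℝ} [IsProbabilityMeasure μ] {L κ ε : ℝ}
    (hL : 0 < L) (hL1 : L ≤ 1) (hκ : 0 ≤ κ) (hκL : κ * L / 2 ≤ 1) (hε : 0 < ε) (hεL : ε ≤ L / 2)
    (hμ : ∀ B ⊆ Set.Icc (-L) L, MeasurableSet B → ENNReal.ofReal κ * volume B ≤ μ B) (n : ℕ) :
    (Measure.pi fun _ : Fin n => μ) {x | ¬ ∀ z ∈ Set.Icc (-(L / 2)) (L / 2),
        ∃ T : Finset (Fin n), |z - ∑ i ∈ T, x i| ≤ 2 * ε}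
      ≤ ENNReal.ofReal ((1 - κ * L / 2) ^ n / ε ^ 2) := by
  set I := Set.Icc (-(L / 2)) (L / 2) with hIdef
  set A := Set.Icc (-ε) ε with hAdef
  have hAI : A ⊆ I := Set.Icc_subset_Icc (by linarith) hεL
  have hI : MeasurableSet I := measurableSet_Icc
  have hA : MeasurableSet A := measurableSet_Icc
  have hIL : volume I = ENNReal.ofReal L := by
    rw [hIdef, Real.volume_Icc]; congr 1; ring
  have hAvol : volume A = ENNReal.ofReal (2 * ε) := by
    rw [hAdef, Real.volume_Icc]; congr 1; ring
  have hA0 : volume A ≠ 0 := by simp [hAvol, hε]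
  have hAreal : volume.real A = 2 * ε := by simp [measureReal_def, hAvol, hε.le]
  have hIreal : volume.real I = L := by simp [measureReal_def, hIL, hL.le]
  have hIfin : volume I ≠ ⊤ := by simp [hIL]
  have hμ' : ∀ z ∈ I, ∀ B ⊆ I, MeasurableSet B →
      ENNReal.ofReal κ * volume B ≤ μ {x | z - x ∈ B} := by
    intro z hz B hBI hB
    have hvol : volume {x | z - x ∈ B} = volume B :=
      (Measure.measurePreserving_sub_left volume z).measure_preimage hB.nullMeasurableSet
    rw [← hvol]
    refine hμ _ (fun x hx => ?_) ((measurable_const.sub measurable_id) hB)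
    have := hBI hx
    constructor <;> linarith [this.1, this.2, hz.1, hz.2]
  have hint := lintegral_uncovered_ratio_pi_le (μ := μ) hL hκ hI hA hAI hIL hA0 hμ' n
  have hmeas : Measurable fun x : Fin n → ℝ =>
      ENNReal.ofReal (L / volume.real {z | (x, z) ∈ reachable I A n} - 1) :=
    (((measurable_measure_prodMk_left
      (measurableSet_reachable hI hA n)).ennreal_toReal.const_div L).sub_const 1).ennreal_ofReal
  have hsub : {x : Fin n → ℝ | ¬ ∀ z ∈ I, ∃ T : Finset (Fin n), |z - ∑ i ∈ T, x i| ≤ 2 * ε}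
      ⊆ {x | ENNReal.ofReal ε ≤
        ENNReal.ofReal (L / volume.real {z | (x, z) ∈ reachable I A n} - 1)} := by
    intro x hx
    by_contra hcon
    refine hx fun z hz => ?_
    set B := {z | (x, z) ∈ reachable I A n} with hB
    have hBI : B ⊆ I := fun z hz => reachable_subset hAI hz
    have hAB : A ⊆ B := fun z hz => subset_reachable hAI x hz
    have hBm : MeasurableSet B := measurable_prodMk_left (measurableSet_reachable hI hA n)
    have hBfin := measure_ne_top_of_subset hBI hIfin
    have hBpos : 0 < volume.real B := by
      have := measureReal_mono hAB hBfin
      rw [hAreal] at this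
      linarith
    have hBL : volume.real B ≤ L := hIreal ▸ measureReal_mono hBI hIfin
    have hlt : L / volume.real B - 1 < ε := by
      rw [Set.mem_ofPred_eq, not_le] at hcon
      exact (ENNReal.ofReal_lt_ofReal_iff hε).1 hcon
    -- The uncovered length is less than `ε` times the covered length, which is at most `L ≤ 1`.
    have hunc : L - volume.real B < ε := by
      have h1 : L / volume.real B < 1 + ε := by linarith
      rw [div_lt_iff₀ hBpos] at h1
      nlinarith
    -- The interval extends from `z` towards `0`, so it stays in `I` because `ε ≤ L / 2`. Its length
    -- `ε` exceeds the uncovered length, so it meets `B`.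
    obtain ⟨J, hJm, hJI, hJz, hJvol⟩ : ∃ J : Set ℝ, MeasurableSet J ∧ J ⊆ I ∧
        (∀ y ∈ J, |z - y| ≤ ε) ∧ volume.real J = ε := by
      rcases le_total z 0 with h | h
      · refine ⟨Set.Icc z (z + ε), measurableSet_Icc, fun y hy => ?_, fun y hy => ?_, ?_⟩
        · exact ⟨hz.1.trans hy.1, by linarith [hy.2]⟩
        · rw [abs_le]; constructor <;> linarith [hy.1, hy.2]
        · simp [hε.le]
      · refine ⟨Set.Icc (z - ε) z, measurableSet_Icc, fun y hy => ?_, fun y hy => ?_, ?_⟩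
        · exact ⟨by linarith [hy.1], hy.2.trans hz.2⟩
        · rw [abs_le]; constructor <;> linarith [hy.1, hy.2]
        · simp [hε.le]
    obtain ⟨y, hyJ, hyB⟩ : ∃ y ∈ J, y ∈ B := by
      by_contra! hdis
      have hd : Disjoint B J := Set.disjoint_left.2 fun y h1 h2 => hdis y h2 h1
      have h2 := measureReal_union hd hJm hBfin (measure_ne_top_of_subset hJI hIfin)
      have h3 : volume.real (B ∪ J) ≤ L :=
        hIreal ▸ measureReal_mono (Set.union_subset hBI hJI) hIfin
      linarith
    obtain ⟨T, hT⟩ := exists_subset_sum_of_reachable hyB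
    refine ⟨T, ?_⟩
    have h1 := hJz y hyJ
    have h2 : |y - ∑ i ∈ T, x i| ≤ ε := abs_le.2 hT
    calc |z - ∑ i ∈ T, x i| = |(z - y) + (y - ∑ i ∈ T, x i)| := by ring_nf
      _ ≤ |z - y| + |y - ∑ i ∈ T, x i| := abs_add_le _ _
      _ ≤ 2 * ε := by linarith
  refine (measure_mono hsub).trans ?_
  -- Markov at level `ε`: one factor `1 / ε` comes from the initial ratio `L / (2 * ε) - 1`, the
  -- other from the threshold.
  refine (meas_ge_le_lintegral_div hmeas.aemeasurable (by simpa using hε) (by simp)).trans ?_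
  refine ENNReal.div_le_of_le_mul (hint.trans ?_)
  have hρ : 0 ≤ 1 - κ * L / 2 := by linarith
  rw [hAreal, ← ENNReal.ofReal_pow hρ, ← ENNReal.ofReal_mul (pow_nonneg hρ n),
    ← ENNReal.ofReal_mul (div_nonneg (pow_nonneg hρ n) (sq_nonneg ε))]
  refine ENNReal.ofReal_le_ofReal ?_
  rw [div_mul_eq_mul_div, mul_div_assoc (_ ^ n)]
  refine mul_le_mul_of_nonneg_left ?_ (pow_nonneg hρ n)
  have h1 : ε / ε ^ 2 = 1 / ε := by field_simp
  rw [h1]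
  have : L / (2 * ε) ≤ 1 / ε := by
    rw [div_le_div_iff₀ (by positivity) hε]
    nlinarith
  linarith

/-! ### The law of products of uniform weights -/

lemma map_pairs_eq_pi {Ω ι : Type*} [Fintype ι] [MeasurableSpace Ω] {P : Measure Ω}
    [IsProbabilityMeasure P] {ν : Measure ℝ} [IsProbabilityMeasure ν] {Z : ι ⊕ ι → Ω → ℝ}
    (hZ : iIndepFun Z P) (hZm : ∀ i, AEMeasurable (Z i) P) (hν : ∀ i, P.map (Z i) = ν)
    {g : ℝ × ℝ → ℝ} (hg : Measurable g) :
    P.map (fun ω k => g (Z (.inl k) ω, Z (.inr k) ω))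
      = Measure.pi fun _ : ι => (ν.prod ν).map g := by
  have h1 : P.map (fun ω i => Z i ω) = Measure.pi fun _ : ι ⊕ ι => ν := by
    rw [(iIndepFun_iff_map_fun_eq_pi_map hZm).1 hZ]
    simp_rw [hν]
  have h2 := measurePreserving_sumPiEquivProdPi (fun _ : ι ⊕ ι => ν)
  have h3 := (measurePreserving_arrowProdEquivProdArrow ℝ ℝ ι (fun _ => ν) (fun _ => ν)).symm
  have hgm : Measurable fun (x : ι → ℝ × ℝ) i => g (x i) :=
    measurable_pi_lambda _ fun i => hg.comp (measurable_pi_apply i)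
  have : IsProbabilityMeasure ((ν.prod ν).map g) :=
    Measure.isProbabilityMeasure_map hg.aemeasurable
  have h4 : MeasurePreserving (fun (x : ι → ℝ × ℝ) i => g (x i))
      (Measure.pi fun _ : ι => ν.prod ν) (Measure.pi fun _ : ι => (ν.prod ν).map g) :=
    ⟨hgm, Measure.pi_map_pi fun _ => hg.aemeasurable⟩
  have h5 := (h4.comp h3).comp h2
  rw [← h5.map_eq, ← h1, AEMeasurable.map_map_of_aemeasurable h5.measurable.aemeasurable
    (aemeasurable_pi_lambda _ hZm)]
  rfl

lemma cond_Icc_neg_one_one_apply (B : Set ℝ) :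
    cond volume (Set.Icc (-1 : ℝ) 1) B
      = ENNReal.ofReal (1 / 2) * volume (Set.Icc (-1 : ℝ) 1 ∩ B) := by
  rw [cond_apply measurableSet_Icc, Real.volume_Icc, ← ENNReal.ofReal_inv_of_pos (by norm_num)]
  norm_num

lemma isProbabilityMeasure_cond_Icc :
    IsProbabilityMeasure (cond volume (Set.Icc (-1 : ℝ) 1)) :=
  cond_isProbabilityMeasure_of_finite (by simp) (by simp)

lemma cond_Icc_mul_ge {a : ℝ} (ha : 1 / 2 ≤ a) (ha1 : a ≤ 1) {B : Set ℝ}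
    (hB : B ⊆ Set.Icc (-(1 / 2)) (1 / 2)) :
    ENNReal.ofReal (1 / 2) * volume B
      ≤ cond volume (Set.Icc (-1 : ℝ) 1) {v | v * a ∈ B} := by
  have ha0 : 0 < a := by linarith
  have hsub : {v | v * a ∈ B} ⊆ Set.Icc (-1 : ℝ) 1 := by
    intro v hv
    have := hB hv
    constructor
    · by_contra! h
      nlinarith [this.1]
    · by_contra! h
      nlinarith [this.2]
  have hvol : volume {v | v * a ∈ B} = ENNReal.ofReal |a⁻¹| * volume B :=
    Real.volume_preimage_mul_right ha0.ne' B
  rw [cond_Icc_neg_one_one_apply, Set.inter_eq_self_of_subset_right hsub, hvol]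
  gcongr
  refine le_mul_of_one_le_left (zero_le) ?_
  rw [ENNReal.one_le_ofReal, abs_of_pos (by positivity)]
  exact (one_le_inv₀ ha0).2 ha1

/-- The product of a uniform variable with the positive part of another one (up to sign) has a law
bounded below by a multiple of Lebesgue measure near `0`. -/
lemma map_mul_max_ge {s : ℝ} (hs : s = 1 ∨ s = -1) {B : Set ℝ} (hBm : MeasurableSet B)
    (hB : B ⊆ Set.Icc (-(1 / 2)) (1 / 2)) :
    ENNReal.ofReal (1 / 8) * volume B
      ≤ ((cond volume (Set.Icc (-1 : ℝ) 1)).prod (cond volume (Set.Icc (-1 : ℝ) 1))).map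
        (fun p => p.2 * max (s * p.1) 0) B := by
  have := isProbabilityMeasure_cond_Icc
  set ν := cond volume (Set.Icc (-1 : ℝ) 1) with hν
  have hg : Measurable fun p : ℝ × ℝ => p.2 * max (s * p.1) 0 := by fun_prop
  -- On this event of probability `1 / 4` the positive part lies in `[1 / 2, 1]`, and the product
  -- has conditional density at least `1 / 2` on `[-1 / 2, 1 / 2]`; hence the constant `1 / 8`.
  set E : Set ℝ := {u | s * u ∈ Set.Icc (1 / 2 : ℝ) 1} with hE
  have hEm : MeasurableSet E := (measurable_const_mul s) measurableSet_Icc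
  have hνE : ENNReal.ofReal (1 / 4) ≤ ν E := by
    have hsub : E ⊆ Set.Icc (-1 : ℝ) 1 := by
      intro u hu
      rcases hs with rfl | rfl <;> constructor <;> linarith [hu.1, hu.2]
    have hvol : volume E = ENNReal.ofReal |s⁻¹| * volume (Set.Icc (1 / 2 : ℝ) 1) :=
      Real.volume_preimage_mul_left (by rcases hs with rfl | rfl <;> norm_num) _
    have hs1 : |s⁻¹| = 1 := by rcases hs with rfl | rfl <;> norm_num
    rw [hν, cond_Icc_neg_one_one_apply, Set.inter_eq_self_of_subset_right hsub, hvol, hs1,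
      Real.volume_Icc, ENNReal.ofReal_one, one_mul, ← ENNReal.ofReal_mul (by norm_num)]
    norm_num
  rw [Measure.map_apply hg hBm, Measure.prod_apply (hg hBm)]
  calc ENNReal.ofReal (1 / 8) * volume B
      = ENNReal.ofReal (1 / 2) * volume B * ENNReal.ofReal (1 / 4) := by
        rw [mul_right_comm, ← ENNReal.ofReal_mul (by norm_num)]
        norm_num
    _ ≤ ENNReal.ofReal (1 / 2) * volume B * ν E := by gcongr
    _ = ∫⁻ u in E, ENNReal.ofReal (1 / 2) * volume B ∂ν := by simp
    _ ≤ ∫⁻ u in E, ν (Prod.mk u ⁻¹' ((fun p : ℝ × ℝ => p.2 * max (s * p.1) 0) ⁻¹' B)) ∂ν := by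
        refine setLIntegral_mono' hEm fun u hu => ?_
        have h := cond_Icc_mul_ge hu.1 hu.2 hB
        have hmax : max (s * u) 0 = s * u := max_eq_left (by linarith [hu.1])
        refine h.trans (measure_mono fun v hv => ?_)
        change v * max (s * u) 0 ∈ B
        rw [hmax]
        exact hv
    _ ≤ _ := setLIntegral_le_lintegral _ _

/-- Subset sums of products of uniform weights with positive parts of uniform weights approximate
every point of `[-1/4, 1/4]`, with high probability. -/
theorem measure_not_subset_sum_approx_le {Ω : Type*} [MeasurableSpace Ω] {P : Measure Ω}
    [IsProbabilityMeasure P] {m : ℕ} {U V : Fin m → Ω → ℝ} (hUV : iIndepFun (Sum.elim U V) P)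
    (hU : ∀ k, pdf.IsUniform (U k) (Set.Icc (-1 : ℝ) 1) P volume)
    (hV : ∀ k, pdf.IsUniform (V k) (Set.Icc (-1 : ℝ) 1) P volume) {s : ℝ} (hs : s = 1 ∨ s = -1)
    {ε : ℝ} (hε : 0 < ε) (hε4 : ε ≤ 1 / 4) :
    P {ω | ¬ ∀ z ∈ Set.Icc (-(1 / 4) : ℝ) (1 / 4), ∃ T : Finset (Fin m),
        |z - ∑ k ∈ T, V k ω * max (s * U k ω) 0| ≤ 2 * ε}
      ≤ ENNReal.ofReal ((31 / 32) ^ m / ε ^ 2) := by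
  have := isProbabilityMeasure_cond_Icc
  have hg : Measurable fun p : ℝ × ℝ => p.2 * max (s * p.1) 0 := by fun_prop
  have huni : ∀ i, pdf.IsUniform (Sum.elim U V i) (Set.Icc (-1 : ℝ) 1) P volume := by
    rintro (i | i)
    exacts [hU i, hV i]
  have haem : ∀ i, AEMeasurable (Sum.elim U V i) P := fun i =>
    (huni i).aemeasurable (by simp) (by simp)
  have hmap := map_pairs_eq_pi hUV haem huni hg
  have hprob := Measure.isProbabilityMeasure_map (μ := (cond volume (Set.Icc (-1 : ℝ) 1)).prod
    (cond volume (Set.Icc (-1 : ℝ) 1))) hg.aemeasurable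
  have key := pi_not_subset_sum_approx_le (L := 1 / 2) (κ := 1 / 8) (by norm_num) (by norm_num)
    (by norm_num) (by norm_num) hε (by linarith) (fun B hB hBm => map_mul_max_ge hs hBm hB) m
  rw [← hmap] at key
  have hX : AEMeasurable (fun ω k => Sum.elim U V (.inr k) ω * max (s * Sum.elim U V (.inl k) ω) 0)
      P := aemeasurable_pi_lambda _ fun k =>
    (haem (.inr k)).mul (((haem (.inl k)).const_mul s).max aemeasurable_const)
  -- The inequality for the image measure needs no measurability of the bad event.
  have h1 := (Measure.le_map_apply hX _).trans key
  norm_num at h1 ⊢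
  exact h1

/-! ### Norm bounds for ReLU and matrices -/

lemma euclidean_norm_le_of_forall_abs_le {b : ℕ} {y : EuclideanSpace ℝ (Fin b)} {c : ℝ}
    (h : ∀ i, |y i| ≤ c) : ‖y‖ ≤ b * c := by
  have h1 : y = ∑ i, EuclideanSpace.single i (y i) := by
    ext j
    simp
  calc ‖y‖ = ‖∑ i, EuclideanSpace.single i (y i)‖ := by rw [← h1]
    _ ≤ ∑ i, ‖EuclideanSpace.single i (y i)‖ := norm_sum_le _ _
    _ ≤ ∑ _i : Fin b, c := Finset.sum_le_sum fun i _ => by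
        simpa using h i
    _ = b * c := by simp

lemma norm_relu_sub_relu_le {m : ℕ} (u v : EuclideanSpace ℝ (Fin m)) :
    ‖relu u - relu v‖ ≤ ‖u - v‖ := by
  rw [EuclideanSpace.norm_eq, EuclideanSpace.norm_eq]
  refine Real.sqrt_le_sqrt (Finset.sum_le_sum fun i _ => ?_)
  have : |max (u i) 0 - max (v i) 0| ≤ |u i - v i| := abs_max_sub_max_le_abs _ _ _
  simpa [relu] using pow_le_pow_left₀ (abs_nonneg _) this 2

lemma norm_relu_le {m : ℕ} (u : EuclideanSpace ℝ (Fin m)) : ‖relu u‖ ≤ ‖u‖ := by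
  have h0 : relu (0 : EuclideanSpace ℝ (Fin m)) = 0 := by
    ext i; simp [relu]
  simpa [h0] using norm_relu_sub_relu_le u 0

lemma norm_applyMat_le {m n : ℕ} (A : Matrix (Fin m) (Fin n) ℝ) (x : EuclideanSpace ℝ (Fin n)) :
    ‖applyMat A x‖ ≤ ‖A‖ * ‖x‖ :=
  Matrix.l2_opNorm_mulVec A x

lemma applyMat_sub {m n : ℕ} (A : Matrix (Fin m) (Fin n) ℝ) (x y : EuclideanSpace ℝ (Fin n)) :
    applyMat A (x - y) = applyMat A x - applyMat A y := by
  ext i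
  simp [applyMat, Matrix.mulVec_sub]

lemma abs_entry_le_norm {m n : ℕ} (A : Matrix (Fin m) (Fin n) ℝ) (i : Fin m) (j : Fin n) :
    |A i j| ≤ ‖A‖ := by
  have h1 := norm_applyMat_le A (EuclideanSpace.single j 1)
  have h2 := PiLp.norm_apply_le (applyMat A (EuclideanSpace.single j 1)) i
  have h3 : applyMat A (EuclideanSpace.single j 1) i = A i j := by
    simp [applyMat]
  rw [h3] at h2
  simpa using h2.trans h1

/-! ### Pruning one block to a given layer -/

/-- The subset sum property of the random weights between an input layer of width `a`, a hidden
layer of width `n` and an output layer of width `b`. The hidden neurons `e (j, g, k)` serve the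
input coordinate `j`. -/
def SubsetSumProperty {a b n m : ℕ} (e : Fin a × Fin 4 × Fin m ↪ Fin n)
    (M₀ : Matrix (Fin n) (Fin a) ℝ) (M₁ : Matrix (Fin b) (Fin n) ℝ) (r s : ℝ)
    (i : Fin b) (j : Fin a) (g : Fin 4) : Prop :=
  ∀ z ∈ Set.Icc (-(1 / 4) : ℝ) (1 / 4), ∃ T : Finset (Fin m),
    |z - ∑ k ∈ T, M₁ i (e (j, g, k)) * max (s * M₀ (e (j, g, k)) j) 0| ≤ r

/-- Selecting neurons with positive weight from `T₁` and the other ones from `T₂` splits the output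
of a block into its responses to the positive and the negative part of the input. -/
lemma sum_selected_eq {m : ℕ} (u v : Fin m → ℝ) (x : ℝ) (T₁ T₂ : Finset (Fin m)) :
    ∑ k, (if (0 < u k ∧ k ∈ T₁) ∨ (¬ 0 < u k ∧ k ∈ T₂) then (1 : ℝ) else 0) * v k *
        max (u k * x) 0
      = (∑ k ∈ T₁, v k * max (1 * u k) 0) * max x 0
        + (∑ k ∈ T₂, v k * max (-1 * u k) 0) * max (-x) 0 := by
  have h (T : Finset (Fin m)) (f : Fin m → ℝ) :
      ∑ k ∈ T, f k = ∑ k, if k ∈ T then f k else 0 := by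
    rw [Finset.sum_ite_mem, Finset.univ_inter]
  rw [Finset.sum_mul, Finset.sum_mul, h T₁, h T₂, ← Finset.sum_add_distrib]
  refine Finset.sum_congr rfl fun k _ => ?_
  rw [one_mul, neg_one_mul]
  rcases lt_or_ge 0 (u k) with hu | hu
  · have h1 : max (u k * x) 0 = u k * max x 0 := by
      rw [mul_max_of_nonneg _ _ hu.le, mul_zero]
    have h2 : max (-u k) 0 = 0 := max_eq_right (by linarith)
    rw [h1, h2, max_eq_left hu.le]
    by_cases hk : k ∈ T₁ <;> simp [hu, hk, mul_assoc]
  · have h1 : max (u k * x) 0 = -u k * max (-x) 0 := by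
      rw [mul_max_of_nonneg _ _ (by linarith : 0 ≤ -u k), mul_zero, neg_mul_neg]
    have h2 : max (-u k) 0 = -u k := max_eq_left (by linarith)
    rw [h1, h2, max_eq_right hu]
    by_cases hk : k ∈ T₂ <;> simp [hu.not_gt, hk, mul_assoc]

theorem exists_masks_approx_layer {a b n m : ℕ} (e : Fin a × Fin 4 × Fin m ↪ Fin n)
    {M₀ : Matrix (Fin n) (Fin a) ℝ} {M₁ : Matrix (Fin b) (Fin n) ℝ} {r : ℝ}
    (hr : 0 ≤ r)
    (h₁ : ∀ i j g, SubsetSumProperty e M₀ M₁ r 1 i j g)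
    (h₂ : ∀ i j g, SubsetSumProperty e M₀ M₁ r (-1) i j g)
    {W : Matrix (Fin b) (Fin a) ℝ} (hW : ‖W‖ ≤ 1) :
    ∃ (S₀ : Matrix (Fin n) (Fin a) ℝ) (S₁ : Matrix (Fin b) (Fin n) ℝ), IsMask S₀ ∧ IsMask S₁ ∧
      ∀ x, ‖applyMat (S₁ ⊙ M₁) (relu (applyMat (S₀ ⊙ M₀) x)) - applyMat W x‖
        ≤ 4 * r * (a * b) * ‖x‖ := by
  classical
  have hWe (i j) : |W i j| ≤ 1 := (abs_entry_le_norm W i j).trans hW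
  have hz₁ (i j) : W i j / 4 ∈ Set.Icc (-(1 / 4) : ℝ) (1 / 4) := by
    have := abs_le.1 (hWe i j)
    constructor <;> linarith [this.1, this.2]
  have hz₂ (i j) : -(W i j / 4) ∈ Set.Icc (-(1 / 4) : ℝ) (1 / 4) := by
    have := abs_le.1 (hWe i j)
    constructor <;> linarith [this.1, this.2]
  -- Subset sums reach only `[-1/4, 1/4]`, so each of the four groups contributes a quarter of `W i
  -- j`; the negative part of the input needs the opposite sign.
  choose T₁ hT₁ using fun i j g => h₁ i j g _ (hz₁ i j)
  choose T₂ hT₂ using fun i j g => h₂ i j g _ (hz₂ i j)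
  let S₀ : Matrix (Fin n) (Fin a) ℝ := fun k j => if ∃ g κ, e (j, g, κ) = k then 1 else 0
  let Q : Fin b → Fin a × Fin 4 × Fin m → Prop := fun i p =>
    (0 < M₀ (e p) p.1 ∧ p.2.2 ∈ T₁ i p.1 p.2.1) ∨ (¬ 0 < M₀ (e p) p.1 ∧ p.2.2 ∈ T₂ i p.1 p.2.1)
  let S₁ : Matrix (Fin b) (Fin n) ℝ := fun i k => if ∃ p, e p = k ∧ Q i p then 1 else 0
  refine ⟨S₀, S₁, fun k j => ?_, fun i k => ?_, fun x => ?_⟩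
  · exact (ite_eq_or_eq _ _ _).symm
  · exact (ite_eq_or_eq _ _ _).symm
  have hS₀ (p : Fin a × Fin 4 × Fin m) (j : Fin a) : S₀ (e p) j = if j = p.1 then 1 else 0 := by
    obtain ⟨j', g, κ⟩ := p
    by_cases h : j = j'
    · subst h
      simp only [S₀, if_true]
      exact if_pos ⟨g, κ, rfl⟩
    · have : ¬ ∃ g' κ', e (j, g', κ') = e (j', g, κ) := by
        rintro ⟨g', κ', h'⟩
        exact h (congrArg Prod.fst (e.injective h'))
      exact (if_neg this).trans (if_neg h).symm
  have hS₁ (i : Fin b) (p : Fin a × Fin 4 × Fin m) : S₁ i (e p) = if Q i p then 1 else 0 := by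
    have : (∃ p', e p' = e p ∧ Q i p') ↔ Q i p := by
      constructor
      · rintro ⟨p', h1, h2⟩
        exact e.injective h1 ▸ h2
      · exact fun h => ⟨p, rfl, h⟩
    simp only [S₁, this]
  have hS₁' (i : Fin b) (k : Fin n) (hk : k ∉ Set.range e) : S₁ i k = 0 := by
    refine if_neg ?_
    rintro ⟨p, hp, -⟩
    exact hk ⟨p, hp⟩
  have hhid (p : Fin a × Fin 4 × Fin m) :
      relu (applyMat (S₀ ⊙ M₀) x) (e p) = max (M₀ (e p) p.1 * x p.1) 0 := by
    simp [relu, applyMat, Matrix.mulVec, dotProduct, hS₀]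
  have hout (i : Fin b) : applyMat (S₁ ⊙ M₁) (relu (applyMat (S₀ ⊙ M₀) x)) i
      = ∑ j, ∑ g, ((∑ k ∈ T₁ i j g, M₁ i (e (j, g, k)) * max (1 * M₀ (e (j, g, k)) j) 0) * max (x j) 0
        + (∑ k ∈ T₂ i j g, M₁ i (e (j, g, k)) * max (-1 * M₀ (e (j, g, k)) j) 0) * max (-x j) 0) := by
    have h1 : applyMat (S₁ ⊙ M₁) (relu (applyMat (S₀ ⊙ M₀) x)) i
        = ∑ k, S₁ i k * M₁ i k * relu (applyMat (S₀ ⊙ M₀) x) k := rfl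
    rw [h1, ← Fintype.sum_of_injective e e.injective
      (fun p => (if Q i p then (1 : ℝ) else 0) * M₁ i (e p) * max (M₀ (e p) p.1 * x p.1) 0) _
      (fun k hk => by rw [hS₁' i k hk, zero_mul, zero_mul])
      (fun p => by rw [hS₁, hhid]),
      Fintype.sum_prod_type]
    refine Finset.sum_congr rfl fun j _ => ?_
    rw [Fintype.sum_prod_type]
    refine Finset.sum_congr rfl fun g _ => ?_
    rw [← sum_selected_eq (fun k => M₀ (e (j, g, k)) j) (fun k => M₁ i (e (j, g, k))) (x j)]
  have hW' (i : Fin b) : applyMat W x i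
      = ∑ j, ∑ _g : Fin 4, (W i j / 4 * max (x j) 0 + -(W i j / 4) * max (-x j) 0) := by
    have h1 : applyMat W x i = ∑ j, W i j * x j := rfl
    rw [h1]
    refine Finset.sum_congr rfl fun j _ => ?_
    have : max (x j) 0 - max (-x j) 0 = x j := by
      rcases le_total (x j) 0 with h | h
      · rw [max_eq_right h, max_eq_left (by linarith)]; ring
      · rw [max_eq_left h, max_eq_right (by linarith)]; ring
    rw [Finset.sum_const, Finset.card_univ, Fintype.card_fin, nsmul_eq_mul]
    push_cast
    linear_combination (-W i j) * this
  have habs (t : ℝ) : max t 0 + max (-t) 0 = |t| := by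
    rcases le_total t 0 with h | h
    · rw [max_eq_right h, max_eq_left (by linarith), abs_of_nonpos h]; ring
    · rw [max_eq_left h, max_eq_right (by linarith), abs_of_nonneg h]; ring
  have hcoord (i : Fin b) :
      |(applyMat (S₁ ⊙ M₁) (relu (applyMat (S₀ ⊙ M₀) x)) - applyMat W x) i| ≤ a * (4 * r * ‖x‖) := by
    rw [PiLp.sub_apply, hout, hW', ← Finset.sum_sub_distrib]
    refine (Finset.abs_sum_le_sum_abs _ _).trans ?_
    calc _ ≤ ∑ _j : Fin a, 4 * r * ‖x‖ := by
          refine Finset.sum_le_sum fun j _ => ?_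
          rw [← Finset.sum_sub_distrib]
          refine (Finset.abs_sum_le_sum_abs _ _).trans ?_
          calc _ ≤ ∑ _g : Fin 4, r * ‖x‖ := by
                refine Finset.sum_le_sum fun g _ => ?_
                have hx : |x j| ≤ ‖x‖ := PiLp.norm_apply_le x j
                have k1 := hT₁ i j g
                have k2 := hT₂ i j g
                rw [abs_sub_comm] at k1 k2
                rw [add_sub_add_comm, ← sub_mul, ← sub_mul]
                refine (abs_add_le _ _).trans ?_
                rw [abs_mul, abs_mul, abs_of_nonneg (le_max_right (x j) 0),
                  abs_of_nonneg (le_max_right (-x j) 0)]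
                refine (add_le_add (mul_le_mul_of_nonneg_right k1 (le_max_right _ _))
                  (mul_le_mul_of_nonneg_right k2 (le_max_right _ _))).trans ?_
                rw [← mul_add, habs]
                exact mul_le_mul_of_nonneg_left hx hr
            _ = 4 * r * ‖x‖ := by simp; ring
      _ = a * (4 * r * ‖x‖) := by simp
  refine (euclidean_norm_le_of_forall_abs_le hcoord).trans (le_of_eq ?_)
  ring

/-! ### Propagation of errors through the layers -/

/-- Since `‖h'‖ ≤ 1 + D`, the block adds at most `e * (1 + D)` to the inherited error `D`. In this
form `1 + D` is simply multiplied by `1 + e` at each layer. -/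
lemma norm_layer_sub_le {m n : ℕ} {F : EuclideanSpace ℝ (Fin n) → EuclideanSpace ℝ (Fin m)}
    {W : Matrix (Fin m) (Fin n) ℝ} {e D : ℝ} (he : 0 ≤ e) (hW : ‖W‖ ≤ 1)
    (hF : ∀ x, ‖F x - applyMat W x‖ ≤ e * ‖x‖) {h h' : EuclideanSpace ℝ (Fin n)}
    (hh : ‖h‖ ≤ 1) (hD : ‖h' - h‖ ≤ D) :
    ‖F h' - applyMat W h‖ ≤ (1 + D) * (1 + e) - 1 := by
  have h1 : ‖h'‖ ≤ 1 + D := by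
    have := norm_add_le h (h' - h)
    rw [add_sub_cancel] at this
    linarith
  have h2 : ‖applyMat W h' - applyMat W h‖ ≤ D := by
    rw [← applyMat_sub]
    refine (norm_applyMat_le W _).trans ?_
    exact (mul_le_of_le_one_left (norm_nonneg _) hW).trans hD
  have h3 := (hF h').trans (mul_le_mul_of_nonneg_left h1 he)
  have h4 := norm_add_le (F h' - applyMat W h') (applyMat W h' - applyMat W h)
  rw [sub_add_sub_cancel] at h4
  linarith

lemma norm_hiddenLayer_le (d : ℕ → ℕ) (W : ∀ i : ℕ, Matrix (Fin (d (i + 1))) (Fin (d i)) ℝ) {l : ℕ}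
    (hW : ∀ i < l, ‖W i‖ ≤ 1) {x : EuclideanSpace ℝ (Fin (d 0))} (hx : ‖x‖ ≤ 1) {k : ℕ}
    (hk : k ≤ l) : ‖hiddenLayer d W x k‖ ≤ 1 := by
  induction k with
  | zero => exact hx
  | succ k ih =>
    refine (norm_relu_le _).trans ((norm_applyMat_le _ _).trans ?_)
    exact mul_le_one₀ (hW k hk) (norm_nonneg _) (ih (by omega))

section
variable (w : ℕ → ℕ) (A : ∀ k : ℕ, Matrix (Fin (w (k + 1))) (Fin (w k)) ℝ)
  (W : ∀ i : ℕ, Matrix (Fin (w (2 * (i + 1)))) (Fin (w (2 * i))) ℝ) {l : ℕ} {e : ℝ}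

lemma norm_hiddenLayer_sub_le (he : 0 ≤ e) (hW : ∀ i < l, ‖W i‖ ≤ 1)
    (hA : ∀ i < l, ∀ x, ‖applyMat (A (2 * i + 1)) (relu (applyMat (A (2 * i)) x))
      - applyMat (W i) x‖ ≤ e * ‖x‖)
    {x : EuclideanSpace ℝ (Fin (w 0))} (hx : ‖x‖ ≤ 1) {k : ℕ} (hk : k ≤ l) :
    ‖hiddenLayer w A x (2 * k) - hiddenLayer (fun i => w (2 * i)) W x k‖ ≤ (1 + e) ^ k - 1 := by
  induction k with
  | zero => simp [hiddenLayer]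
  | succ k ih =>
    have h1 := norm_layer_sub_le he (hW k hk) (hA k hk)
      (norm_hiddenLayer_le (fun i => w (2 * i)) W hW hx (by omega : k ≤ l)) (ih (by omega))
    refine (norm_relu_sub_relu_le _ _).trans (h1.trans (le_of_eq ?_))
    ring

theorem norm_reluNetwork_sub_le (he : 0 ≤ e) (hl : 1 ≤ l) (hW : ∀ i < l, ‖W i‖ ≤ 1)
    (hA : ∀ i < l, ∀ x, ‖applyMat (A (2 * i + 1)) (relu (applyMat (A (2 * i)) x))
      - applyMat (W i) x‖ ≤ e * ‖x‖)
    {x : EuclideanSpace ℝ (Fin (w 0))} (hx : ‖x‖ ≤ 1) :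
    ‖reluNetwork w A (2 * l) x - reluNetwork (fun i => w (2 * i)) W l x‖ ≤ (1 + e) ^ l - 1 := by
  obtain ⟨k, rfl⟩ : ∃ k, l = k + 1 := ⟨l - 1, by omega⟩
  have h1 := norm_layer_sub_le he (hW k (by omega)) (hA k (by omega))
    (norm_hiddenLayer_le (fun i => w (2 * i)) W hW hx (by omega : k ≤ k + 1))
    (norm_hiddenLayer_sub_le w A W he hW hA hx (by omega : k ≤ k + 1))
  refine h1.trans (le_of_eq ?_)
  ring

end

/-! ### Constants, union bounds and assembly -/

/-- Interleaves the two masks of every block into one dependent family. Quantifying over the index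
equations makes the transports trivial once the equation is `rfl`. -/
lemma exists_family_of_even_odd {α : ℕ → Type*} (f : ∀ i, α (2 * i)) (g : ∀ i, α (2 * i + 1)) :
    ∃ s : ∀ k, α k, (∀ i, s (2 * i) = f i) ∧ ∀ i, s (2 * i + 1) = g i := by
  have h : ∀ k, ∃ y : α k, (∀ i (h : 2 * i = k), y = h ▸ f i) ∧
      ∀ i (h : 2 * i + 1 = k), y = h ▸ g i := by
    intro k
    rcases Nat.even_or_odd' k with ⟨j, rfl | rfl⟩
    · refine ⟨f j, fun i h => ?_, fun i h => by omega⟩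
      obtain rfl : i = j := by omega
      rfl
    · refine ⟨g j, fun i h => by omega, fun i h => ?_⟩
      obtain rfl : i = j := by omega
      rfl
  choose s hs using h
  exact ⟨s, fun i => (hs _).1 i rfl, fun i => (hs _).2 i rfl⟩

/-- Since `31 / 32 ≤ exp (-1 / 32)`, the power is at most `q ^ (-16)`; three factors absorb `q ^ 3`,
and `q ≥ 2` lets the other thirteen absorb `8192 = 2 ^ 13`. -/
lemma mul_geometric_le_one {q : ℝ} (hq : 2 ≤ q) {m : ℕ} (hm : 512 * Real.log q ≤ m) :
    8192 * q ^ 3 * (31 / 32) ^ m ≤ 1 := by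
  have hq0 : 0 < q := by linarith
  have h1 : (31 / 32 : ℝ) ^ m ≤ Real.exp (-(16 * Real.log q)) := by
    have h2 : (31 / 32 : ℝ) ≤ Real.exp (-(1 / 32)) := by
      have := Real.add_one_le_exp (-(1 / 32 : ℝ))
      linarith
    refine (pow_le_pow_left₀ (by norm_num) h2 m).trans ?_
    rw [← Real.exp_nat_mul]
    exact Real.exp_le_exp.2 (by linarith)
  have h3 : Real.exp (-(16 * Real.log q)) = (q ^ 16)⁻¹ := by
    rw [Real.exp_neg, show (16 : ℝ) * Real.log q = (16 : ℕ) * Real.log q by norm_num,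
      Real.exp_nat_mul, Real.exp_log hq0]
  rw [h3] at h1
  have h4 : (8192 : ℝ) ≤ q ^ 13 := by
    have := pow_le_pow_left₀ (by norm_num) hq 13
    norm_num at this
    exact this
  calc 8192 * q ^ 3 * (31 / 32) ^ m ≤ q ^ 13 * q ^ 3 * (q ^ 16)⁻¹ := by gcongr
    _ = 1 := by field_simp

/-- Every matrix of spectral norm at most `1` is approximated, up to the relative error `e`, by a
pruning of the two-layer ReLU network with weights `M₀` and `M₁`. -/
def ApproximatesLayers {a n b : ℕ} (M₀ : Matrix (Fin n) (Fin a) ℝ) (M₁ : Matrix (Fin b) (Fin n) ℝ)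
    (e : ℝ) : Prop :=
  ∀ W : Matrix (Fin b) (Fin a) ℝ, ‖W‖ ≤ 1 →
    ∃ (S₀ : Matrix (Fin n) (Fin a) ℝ) (S₁ : Matrix (Fin b) (Fin n) ℝ), IsMask S₀ ∧ IsMask S₁ ∧
      ∀ x, ‖applyMat (S₁ ⊙ M₁) (relu (applyMat (S₀ ⊙ M₀) x)) - applyMat W x‖ ≤ e * ‖x‖

lemma iIndepFun_block {Ω : Type*} [MeasurableSpace Ω] {P : Measure Ω} {w : ℕ → ℕ} {l : ℕ}
    {M : ∀ k : ℕ, Ω → Matrix (Fin (w (k + 1))) (Fin (w k)) ℝ} (hM : IsUniformInit P w (2 * l) M)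
    {i m : ℕ} (hi : i < l) (e : Fin m ↪ Fin (w (2 * i + 1))) (j : Fin (w (2 * i)))
    (t : Fin (w (2 * (i + 1)))) :
    iIndepFun (Sum.elim (fun k ω => M (2 * i) ω (e k) j) (fun k ω => M (2 * i + 1) ω t (e k))) P := by
  let g : Fin m ⊕ Fin m → Σ k : Fin (2 * l), Fin (w (k + 1)) × Fin (w k) :=
    Sum.elim (fun k => ⟨⟨2 * i, by omega⟩, (e k, j)⟩) (fun k => ⟨⟨2 * i + 1, by omega⟩, (t, e k)⟩)
  have hg : g.Injective := by
    rintro (k | k) (k' | k') h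
    · simpa [g] using h
    · have h' := congrArg (fun p => (p.1 : ℕ)) h
      simp [g] at h'
    · have h' := congrArg (fun p => (p.1 : ℕ)) h
      simp [g] at h'
    · simpa [g] using h
  have h := hM.1.precomp hg
  convert h using 1
  funext k
  rcases k with k | k <;> rfl

lemma measure_not_approximatesLayers_le {Ω : Type*} [MeasurableSpace Ω] {P : Measure Ω}
    [IsProbabilityMeasure P] {w : ℕ → ℕ} {l : ℕ}
    {M : ∀ k : ℕ, Ω → Matrix (Fin (w (k + 1))) (Fin (w k)) ℝ} (hM : IsUniformInit P w (2 * l) M)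
    {i : ℕ} (hi : i < l) (ha : 1 ≤ w (2 * i)) (hb : 1 ≤ w (2 * (i + 1))) {η : ℝ} (hη : 0 < η)
    (hq : 2 ≤ (w (2 * i) : ℝ) * (w (2 * (i + 1)) : ℝ) * (l : ℝ) / η)
    (hn : 2056 * (w (2 * i) : ℝ) *
      Real.log ((w (2 * i) : ℝ) * (w (2 * (i + 1)) : ℝ) * (l : ℝ) / η) ≤ (w (2 * i + 1) : ℝ)) :
    P {ω | ¬ ApproximatesLayers (M (2 * i) ω) (M (2 * i + 1) ω) (η / (4 * l))}
      ≤ ENNReal.ofReal (η / l) := by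
  set a := w (2 * i) with hadef
  set b := w (2 * (i + 1)) with hbdef
  set n := w (2 * i + 1) with hndef
  set q : ℝ := (a : ℝ) * (b : ℝ) * (l : ℝ) / η with hqdef
  have ha0 : (0 : ℝ) < a := by exact_mod_cast ha
  have hb0 : (0 : ℝ) < b := by exact_mod_cast hb
  have hl0 : (0 : ℝ) < l := by exact_mod_cast (by omega : 0 < l)
  have hq0 : 0 < q := by linarith
  set m := n / (4 * a) with hmdef
  -- The constant is `2056 = 4 * 514`. The surplus `2 * log q ≥ 2 * log 2 > 1` pays for the rounding
  -- in `m`.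
  have hm : 512 * Real.log q ≤ m := by
    have h1 : n < (m + 1) * (4 * a) := by
      rw [mul_comm]
      exact Nat.lt_mul_div_succ n (by omega)
    have h2 : (n : ℝ) < ((m : ℝ) + 1) * (4 * a) := by exact_mod_cast h1
    have h3 : 514 * Real.log q < m + 1 := by
      have : (514 * Real.log q) * (4 * a) < ((m : ℝ) + 1) * (4 * a) := by
        refine lt_of_le_of_lt ?_ h2
        refine le_trans (le_of_eq ?_) hn
        ring
      exact lt_of_mul_lt_mul_right this (by positivity)
    have h4 : Real.log 2 ≤ Real.log q := Real.log_le_log (by norm_num) hq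
    have h5 := Real.log_two_gt_d9
    linarith
  have hcard : Fintype.card (Fin a × Fin 4 × Fin m) ≤ Fintype.card (Fin n) := by
    simp only [Fintype.card_prod, Fintype.card_fin]
    calc a * (4 * m) = 4 * a * (n / (4 * a)) := by rw [hmdef]; ring
      _ ≤ n := Nat.mul_div_le _ _
  obtain ⟨e⟩ := Function.Embedding.nonempty_of_card_le hcard
  -- Chosen so that the block error `4 * (2 * r) * (a * b)` equals `η / (4 * l)`.
  set r : ℝ := 1 / (32 * q) with hr
  have hr0 : 0 < r := by positivity
  have hr4 : r ≤ 1 / 4 := by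
    rw [hr, div_le_div_iff₀ (by positivity) (by norm_num)]
    linarith
  let s : Bool → ℝ := fun c => if c then 1 else -1
  let bad : Fin b × Fin a × Fin 4 × Bool → Set Ω := fun p =>
    {ω | ¬ SubsetSumProperty e (M (2 * i) ω) (M (2 * i + 1) ω) (2 * r) (s p.2.2.2) p.1 p.2.1
      p.2.2.1}
  have hbad (p) : P (bad p) ≤ ENNReal.ofReal ((31 / 32) ^ m / r ^ 2) := by
    obtain ⟨t, j, g, c⟩ := p
    let e' : Fin m ↪ Fin n := ⟨fun k => e (j, g, k), fun k k' h => by simpa using h⟩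
    exact measure_not_subset_sum_approx_le (iIndepFun_block hM hi e' j t)
      (fun k => hM.2 (2 * i) (by omega) _ _) (fun k => hM.2 (2 * i + 1) (by omega) _ _)
      (s := s c) (by cases c <;> simp [s]) hr0 hr4
  have hsub : {ω | ¬ ApproximatesLayers (M (2 * i) ω) (M (2 * i + 1) ω) (η / (4 * l))}
      ⊆ ⋃ p, bad p := by
    intro ω hω
    by_contra hcon
    have hgood : ∀ p, ω ∉ bad p := by simpa using hcon
    refine hω fun W hW => ?_
    obtain ⟨S₀, S₁, h₀, h₁, h⟩ := exists_masks_approx_layer e (r := 2 * r) (by positivity)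
      (fun t j g => not_not.1 (hgood (t, j, g, true)))
      (fun t j g => not_not.1 (hgood (t, j, g, false))) hW
    refine ⟨S₀, S₁, h₀, h₁, fun x => (h x).trans (le_of_eq ?_)⟩
    congr 1
    rw [hr, hqdef]
    field_simp
    norm_num
  calc _ ≤ P (⋃ p, bad p) := measure_mono hsub
    _ ≤ ∑ p, P (bad p) := measure_iUnion_fintype_le _ _
    _ ≤ ∑ _p : Fin b × Fin a × Fin 4 × Bool, ENNReal.ofReal ((31 / 32) ^ m / r ^ 2) :=
        Finset.sum_le_sum fun p _ => hbad p
    _ = ENNReal.ofReal ((8 * a * b : ℝ) * ((31 / 32) ^ m / r ^ 2)) := by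
        rw [Finset.sum_const, Finset.card_univ, ← ENNReal.ofReal_nsmul, nsmul_eq_mul]
        congr 2
        simp only [Fintype.card_prod, Fintype.card_fin, Fintype.card_bool]
        push_cast
        ring
    _ ≤ ENNReal.ofReal (η / l) := by
        refine ENNReal.ofReal_le_ofReal ?_
        have h1 := mul_geometric_le_one hq hm
        have h2 : (8 * a * b : ℝ) * ((31 / 32) ^ m / r ^ 2)
            = η / l * (8192 * q ^ 3 * (31 / 32) ^ m) := by
          have hab : (a : ℝ) * b = q * (η / l) := by
            rw [hqdef]; field_simp
          have hr2 : (31 / 32 : ℝ) ^ m / r ^ 2 = 1024 * q ^ 2 * (31 / 32) ^ m := by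
            rw [hr]; field_simp; norm_num
          rw [hr2, mul_assoc 8, hab]
          ring
        rw [h2]
        exact mul_le_of_le_one_right (by positivity) h1

lemma one_add_pow_sub_one_le {l : ℕ} {η : ℝ} (hl : 1 ≤ l) (hη : 0 ≤ η) (hη1 : η ≤ 1) :
    (1 + η / (4 * l)) ^ l - 1 ≤ η / 2 := by
  have hl0 : (0 : ℝ) < l := by exact_mod_cast hl
  have h1 : (1 + η / (4 * l)) ^ l ≤ Real.exp (η / 4) := by
    have h2 : 1 + η / (4 * l) ≤ Real.exp (η / (4 * l)) := by
      have := Real.add_one_le_exp (η / (4 * l))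
      linarith
    refine (pow_le_pow_left₀ (by positivity) h2 l).trans ?_
    rw [← Real.exp_nat_mul]
    refine Real.exp_le_exp.2 (le_of_eq ?_)
    field_simp
  have h3 : |η / 4| ≤ 1 := by rw [abs_of_nonneg (by positivity)]; linarith
  have h4 := (abs_le.1 (Real.abs_exp_sub_one_le h3)).2
  rw [abs_of_nonneg (by positivity)] at h4
  linarith

/-- If every pair of consecutive random layers approximates all single layers, then prunings of the
whole random network approximate all target networks. -/
lemma exists_masks_of_approximatesLayers {w : ℕ → ℕ} {l : ℕ} (hl : 1 ≤ l)
    {N : ∀ k : ℕ, Matrix (Fin (w (k + 1))) (Fin (w k)) ℝ} {ε η : ℝ} (hη : 0 < η) (hη1 : η ≤ 1)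
    (hηε : η ≤ ε)
    (h : ∀ i < l, ApproximatesLayers (N (2 * i)) (N (2 * i + 1)) (η / (4 * l)))
    {f : EuclideanSpace ℝ (Fin (w 0)) → EuclideanSpace ℝ (Fin (w (2 * l)))}
    (hf : f ∈ targetClass (fun i => w (2 * i)) l) :
    ∃ S : ∀ k : ℕ, Matrix (Fin (w (k + 1))) (Fin (w k)) ℝ,
      (∀ k, IsMask (S k)) ∧
      (⨆ x ∈ Metric.closedBall (0 : EuclideanSpace ℝ (Fin (w 0))) 1,
          edist (f x) (reluNetwork w (fun k => S k ⊙ N k) (2 * l) x))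
        < ENNReal.ofReal ε := by
  obtain ⟨W, hW, rfl⟩ := hf
  have hS : ∀ i, ∃ (S₀ : Matrix (Fin (w (2 * i + 1))) (Fin (w (2 * i))) ℝ)
      (S₁ : Matrix (Fin (w (2 * i + 1 + 1))) (Fin (w (2 * i + 1))) ℝ), IsMask S₀ ∧ IsMask S₁ ∧
      (i < l → ∀ x, ‖applyMat (S₁ ⊙ N (2 * i + 1)) (relu (applyMat (S₀ ⊙ N (2 * i)) x))
        - applyMat (W i) x‖ ≤ η / (4 * l) * ‖x‖) := by
    intro i
    by_cases hi : i < l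
    · obtain ⟨S₀, S₁, h₀, h₁, h'⟩ := h i hi (W i) (hW i hi)
      exact ⟨S₀, S₁, h₀, h₁, fun _ => h'⟩
    · exact ⟨0, 0, fun _ _ => Or.inl rfl, fun _ _ => Or.inl rfl, fun h' => absurd h' hi⟩
  choose S₀ S₁ h₀ h₁ hS using hS
  obtain ⟨S, hS₀, hS₁⟩ := exists_family_of_even_odd
    (α := fun k => Matrix (Fin (w (k + 1))) (Fin (w k)) ℝ) S₀ S₁
  refine ⟨S, fun k => ?_, ?_⟩
  · rcases Nat.even_or_odd' k with ⟨i, rfl | rfl⟩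
    · rw [hS₀]; exact h₀ i
    · rw [hS₁]; exact h₁ i
  have happrox : ∀ i < l, ∀ x, ‖applyMat ((fun k => S k ⊙ N k) (2 * i + 1))
      (relu (applyMat ((fun k => S k ⊙ N k) (2 * i)) x)) - applyMat (W i) x‖
        ≤ η / (4 * l) * ‖x‖ := by
    intro i hi x
    have := hS i hi x
    rw [← hS₀, ← hS₁] at this
    exact this
  refine lt_of_le_of_lt (b := ENNReal.ofReal (η / 2)) (iSup₂_le fun x hx => ?_)
    ((ENNReal.ofReal_lt_ofReal_iff (by linarith)).2 (by linarith))
  have hx1 : ‖x‖ ≤ 1 := by simpa using hx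
  have h2 := norm_reluNetwork_sub_le w (fun k => S k ⊙ N k) W (by positivity) hl hW happrox hx1
  rw [edist_comm, edist_dist, dist_eq_norm]
  exact ENNReal.ofReal_le_ofReal (h2.trans (one_add_pow_sub_one_le hl hη.le hη1))

/-- The ratio can fall below `2` only if the integer `w (2 * i) * w (2 * (i + 1)) * l` is `1`, which
is the degenerate case of the theorem. -/
lemma two_le_width_ratio {l : ℕ} {w : ℕ → ℕ} {η : ℝ} (hw : ∀ i ≤ l, 1 ≤ w (2 * i)) (hη : 0 < η)
    (hη1 : η ≤ 1) (hdeg : l = 1 → w 0 = 1 → w 2 = 1 → η ≤ 1 / 2) {i : ℕ} (hi : i < l) :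
    2 ≤ (w (2 * i) : ℝ) * (w (2 * (i + 1)) : ℝ) * (l : ℝ) / η := by
  have ha := hw i hi.le
  have hb := hw (i + 1) hi
  rw [le_div_iff₀ hη]
  by_cases h : 2 ≤ w (2 * i) * w (2 * (i + 1)) * l
  · have : (2 : ℝ) ≤ (w (2 * i) : ℝ) * (w (2 * (i + 1)) : ℝ) * (l : ℝ) := by exact_mod_cast h
    linarith
  · have h1 : w (2 * i) * w (2 * (i + 1)) * l = 1 := by
      have : 0 < w (2 * i) * w (2 * (i + 1)) * l := by
        have : 0 < l := by omega
        positivity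
      omega
    have h2 : l = 1 := Nat.eq_one_of_mul_eq_one_left h1
    have h3 := Nat.eq_one_of_mul_eq_one_right h1
    have h4 : w (2 * i) = 1 := Nat.eq_one_of_mul_eq_one_right h3
    have h5 : w (2 * (i + 1)) = 1 := Nat.eq_one_of_mul_eq_one_left h3
    obtain rfl : i = 0 := by omega
    have := hdeg h2 h4 h5
    have h6 : (w (2 * 0) : ℝ) * (w (2 * (0 + 1)) : ℝ) * (l : ℝ) = 1 := by exact_mod_cast h1
    linarith

/-- The random network has `2 * l` layers and widths `w 0, …, w (2 * l)`; the target network has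
`l` layers and widths `d i = w (2 * i)`, and `w (2 * i + 1)` is the width of the extra hidden layer
between `d i` and `d (i + 1)`. -/
theorem theorem1 :
    ∃ C : ℝ, 0 < C ∧
      ∀ (l : ℕ) (w : ℕ → ℕ) (ε δ : ℝ),
        1 ≤ l → (∀ i ≤ l, 1 ≤ w (2 * i)) → 0 < ε → 0 < δ → δ < 1 →
        (l = 1 → w 0 = 1 → w 2 = 1 → min ε δ ≤ 1 / 2) →
        (∀ i < l, C * (w (2 * i) : ℝ) *
            Real.log ((w (2 * i) : ℝ) * (w (2 * (i + 1)) : ℝ) * (l : ℝ) / min ε δ)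
              ≤ (w (2 * i + 1) : ℝ)) →
        ∀ (Ω : Type*) [MeasurableSpace Ω] (P : Measure Ω) [IsProbabilityMeasure P]
          (M : ∀ k : ℕ, Ω → Matrix (Fin (w (k + 1))) (Fin (w k)) ℝ),
          IsUniformInit P w (2 * l) M →
          ENNReal.ofReal (1 - δ) ≤
            P {ω | ∀ f ∈ targetClass (fun i => w (2 * i)) l,
              ∃ S : ∀ k : ℕ, Matrix (Fin (w (k + 1))) (Fin (w k)) ℝ,
                (∀ k, IsMask (S k)) ∧
                (⨆ x ∈ Metric.closedBall (0 : EuclideanSpace ℝ (Fin (w 0))) 1,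
                    edist (f x) (reluNetwork w (fun k => S k ⊙ M k ω) (2 * l) x))
                  < ENNReal.ofReal ε} := by
  refine ⟨2056, by norm_num, ?_⟩
  intro l w ε δ hl hw hε hδ hδ1 hdeg hn Ω _ P _ M hM
  have hη : 0 < min ε δ := lt_min hε hδ
  have hη1 : min ε δ ≤ 1 := (min_le_right _ _).trans hδ1.le
  have hl0 : (0 : ℝ) < l := by exact_mod_cast hl
  set good := {ω | ∀ f ∈ targetClass (fun i => w (2 * i)) l,
              ∃ S : ∀ k : ℕ, Matrix (Fin (w (k + 1))) (Fin (w k)) ℝ,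
                (∀ k, IsMask (S k)) ∧
                (⨆ x ∈ Metric.closedBall (0 : EuclideanSpace ℝ (Fin (w 0))) 1,
                    edist (f x) (reluNetwork w (fun k => S k ⊙ M k ω) (2 * l) x))
                  < ENNReal.ofReal ε}
  have hsub : goodᶜ ⊆ ⋃ i : Fin l, {ω | ¬ ApproximatesLayers (M (2 * i) ω) (M (2 * i + 1) ω)
      (min ε δ / (4 * l))} := by
    intro ω hω
    by_contra hcon
    have hall : ∀ i : Fin l, ApproximatesLayers (M (2 * i) ω) (M (2 * i + 1) ω)
        (min ε δ / (4 * l)) := by simpa using hcon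
    have hall' : ∀ i < l, ApproximatesLayers (M (2 * i) ω) (M (2 * i + 1) ω)
        (min ε δ / (4 * l)) := fun i hi => hall ⟨i, hi⟩
    refine hω ?_
    intro f hf
    exact exists_masks_of_approximatesLayers (N := fun k => M k ω) hl hη hη1 (min_le_left _ _)
      hall' hf
  have hlayer (i : Fin l) : P {ω | ¬ ApproximatesLayers (M (2 * i) ω) (M (2 * i + 1) ω)
      (min ε δ / (4 * l))} ≤ ENNReal.ofReal (min ε δ / l) :=
    measure_not_approximatesLayers_le (i := (i : ℕ)) (η := min ε δ) hM i.2 (hw i i.2.le)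
      (hw (i + 1) i.2) hη (two_le_width_ratio hw hη hη1 hdeg i.2) (hn i i.2)
  have hbad : P goodᶜ ≤ ENNReal.ofReal δ := by
    calc P goodᶜ ≤ ∑ i : Fin l, P {ω | ¬ ApproximatesLayers (M (2 * i) ω) (M (2 * i + 1) ω)
            (min ε δ / (4 * l))} := (measure_mono hsub).trans (measure_iUnion_fintype_le _ _)
      _ ≤ ∑ _i : Fin l, ENNReal.ofReal (min ε δ / l) := Finset.sum_le_sum fun i _ => hlayer i
      _ = ENNReal.ofReal (min ε δ) := by
          rw [Finset.sum_const, Finset.card_univ, Fintype.card_fin, ← ENNReal.ofReal_nsmul,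
            nsmul_eq_mul, mul_div_cancel₀ _ hl0.ne']
      _ ≤ ENNReal.ofReal δ := ENNReal.ofReal_le_ofReal (min_le_right _ _)
  rw [ENNReal.ofReal_sub _ hδ.le, ENNReal.ofReal_one, tsub_le_iff_right]
  -- Subadditivity suffices, so `good` need not be measurable.
  calc (1 : ENNReal) = P (good ∪ goodᶜ) := by rw [Set.union_compl_self, measure_univ]
    _ ≤ P good + P goodᶜ := measure_union_le _ _
    _ ≤ P good + ENNReal.ofReal δ := by gcongr
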